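/- Let $\Sigma$ be a finite nonempty alphabet. A $\Sigma$-labelled tree is a map $t\colon\{\mathsf L,\mathsf R\}^*\to\Sigma$; $\mathrm{Tr}_\Sigma$ is the set of all of them. A (top-down nondeterministic) parity tree automaton is $\mathcal A=\langle\Sigma,Q,q_0,\Omega,\Delta\rangle$ with $Q$ a finite set of states, $q_0\in Q$, $\Omega\colon Q\to\mathbb N$ and $\Delta\subseteq Q\times\Sigma\times Q\times Q$. A run of $\mathcal A$ over $t$ is a map $\rho\colon\{\mathsf L,\mathsf R\}^*\to Q$ with $\rho(\epsilon)=q_0$ and $(\rho(u),t(u),\rho(u\mathsf L),\rho(u\mathsf R))\in\Delta$ for every node $u$; it is accepting if along every branch the maximal priority occurring infinitely often is even. $L(\mathcal A)$ is the set of trees over which $\mathcal A$ has an accepting run, and $\mathcal A_q$ is $\mathcal A$ with initial state changed to $q$. Write $\Delta(q,a)$ for the set of transitions in $\Delta$ of the form $(q,a,\cdot,\cdot)$. $\mathcal A$ is a game automaton with distinguished state $\top\in Q$ if $\top\neq q_0$, $L(\mathcal A_\top)=\mathrm{Tr}_\Sigma$, and for every $q\in Q\setminus\{\top\}$ and $a\in\Sigma$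 there are $q_{\mathsf L},q_{\mathsf R}\in Q\setminus\{\top\}$ such that either $\Delta(q,a)=\{(q,a,q_{\mathsf L},q_{\mathsf R})\}$ (conjunctive) or $\Delta(q,a)=\{(q,a,q_{\mathsf L},\top),(q,a,\top,q_{\mathsf R})\}$ (disjunctive). Let $\mathcal A$ be a game automaton with distinguished state $\top$. For $e\in\mathbb N$ let $\mathcal A^{\mathrm c}_{(e)}=\langle\Sigma,Q,q_0,\Omega^{\mathrm c},\Delta^{\mathrm c}\rangle$ be its dual: for $q\neq\top$ put $\Omega^{\mathrm c}(q)=\Omega(q)+1$, and replace a conjunctive $\Delta(q,a)=\{(q,a,q_{\mathsf L},q_{\mathsf R})\}$ by the disjunctive $\Delta^{\mathrm c}(q,a)=\{(q,a,q_{\mathsf L},\top),(q,a,\top,q_{\mathsf R})\}$ and vice versa; the state $\top$ has $\Omega^{\mathrm c}(\top)=e$ and $\Delta^{\mathrm c}(\top,a)=\{(\top,a,\top,\top)\}$. Then: 1. For every even $e$, $\mathcal A^{\mathrm c}_{(e)}$ (which has the same set of states as $\mathcal A$) is a game automaton with distinguished state $\top$, $L(\mathcal A^{\mathrm c}_{(e)})=\mathrm{Tr}_\Sigma\setminus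 L(\mathcal A)$, and $L((\mathcal A^{\mathrm c}_{(e)})_q)=\mathrm{Tr}_\Sigma\setminus L(\mathcal A_q)$ for every $q\in Q\setminus\{\top\}$. 2. $|\Omega^{\mathrm c}(Q\setminus\{\top\})|=|\Omega(Q\setminus\{\top\})|$, i.e. the number of priorities of the states other than $\top$ is the same. 3. If some state of $\mathcal A$ has an odd priority, then $e$ can be chosen even such that also $|\Omega^{\mathrm c}(Q)|=|\Omega(Q)|$. If all priorities of $\mathcal A$ are even, then $L(\mathcal A)=\mathrm{Tr}_\Sigma$. -/

import Mathlib

/-- The two directions of the full binary tree. -/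
inductive Dir where
  | left
  | right

/-- An `α`-labelled full infinite binary tree.  A node is the finite word of directions leading to
it from the root: the root is `[]`, and the child of `u` in direction `d` is `u ++ [d]`. -/
abbrev LTree (α : Type*) := List Dir → α

/-- The node `d₀ d₁ ⋯ dᵢ₋₁` on the branch `d₀ d₁ ⋯`. -/
def branchNode (d : ℕ → Dir) (i : ℕ) : List Dir := (List.range i).map d

/-- A sequence of priorities is accepting if the maximal priority that occurs infinitely often
is even. -/
def ParityAccepting (c : ℕ → ℕ) : Prop :=
  ∃ m : ℕ, Even m ∧ (∃ᶠ i in Filter.atTop, c i = m) ∧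
    ∀ k : ℕ, (∃ᶠ i in Filter.atTop, c i = k) → k ≤ m

/-- Top-down nondeterministic parity tree automata over the alphabet `α` with set of states `Q`. -/
structure TreeAutomaton (α Q : Type*) where
  init : Q
  Ω : Q → ℕ
  Δ : Set (Q × α × Q × Q)

namespace TreeAutomaton

variable {α Q : Type*}

/-- The transitions `Δ(q, a)` from the state `q` over the letter `a`. -/
def transFrom (A : TreeAutomaton α Q) (q : Q) (a : α) : Set (Q × α × Q × Q) :=
  {δ | δ ∈ A.Δ ∧ δ.1 = q ∧ δ.2.1 = a}

/-- `ρ` is a run of `A` over the tree `t`. -/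
def IsRun (A : TreeAutomaton α Q) (t : LTree α) (ρ : LTree Q) : Prop :=
  ρ [] = A.init ∧ ∀ u : List Dir, (ρ u, t u, ρ (u ++ [Dir.left]), ρ (u ++ [Dir.right])) ∈ A.Δ

/-- A run is accepting if along every branch the sequence of states is accepting. -/
def IsAccepting (A : TreeAutomaton α Q) (ρ : LTree Q) : Prop :=
  ∀ d : ℕ → Dir, ParityAccepting (fun i => A.Ω (ρ (branchNode d i)))

/-- The language recognised by `A`. -/
def language (A : TreeAutomaton α Q) : Set (LTree α) :=
  {t | ∃ ρ : LTree Q, A.IsRun t ρ ∧ A.IsAccepting ρ}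

/-- The automaton `A_q`: the same as `A`, but with initial state `q`. -/
def withInit (A : TreeAutomaton α Q) (q : Q) : TreeAutomaton α Q := { A with init := q }

/-- `Δ(q, a)` is a single conjunctive transition. -/
def IsConjunctive (A : TreeAutomaton α Q) (top q : Q) (a : α) : Prop :=
  ∃ l r : Q, l ≠ top ∧ r ≠ top ∧ A.transFrom q a = {(q, a, l, r)}

/-- `Δ(q, a)` is a pair of disjunctive transitions. -/
def IsDisjunctive (A : TreeAutomaton α Q) (top q : Q) (a : α) : Prop :=
  ∃ l r : Q, l ≠ top ∧ r ≠ top ∧ A.transFrom q a = {(q, a, l, top), (q, a, top, r)}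

/-- `A` is a game automaton with distinguished state `top`.  About the transitions and the priority
of `top` itself nothing is assumed except that `top` accepts every tree. -/
structure IsGame (A : TreeAutomaton α Q) (top : Q) : Prop where
  top_ne_init : top ≠ A.init
  language_top : (A.withInit top).language = Set.univ
  conj_or_disj : ∀ q : Q, q ≠ top → ∀ a : α, A.IsConjunctive top q a ∨ A.IsDisjunctive top q a

open Classical in
/-- The syntactic dual of a game automaton `A`: conjunctive and disjunctive transitions are
swapped, and all priorities are increased by one.  The distinguished state `top` is not dualised: it
loops with priority `e` (an even number, in order that `top` accepts every tree). -/
noncomputable def dual (A : TreeAutomaton α Q) (top : Q) (e : ℕ) : TreeAutomaton α Q where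
  init := A.init
  Ω q := if q = top then e else A.Ω q + 1
  Δ :=
    {δ | ∃ (q : Q) (a : α) (l r : Q), q ≠ top ∧ l ≠ top ∧ r ≠ top ∧
        (q, a, l, r) ∈ A.Δ ∧ (δ = (q, a, l, top) ∨ δ = (q, a, top, r))} ∪
    {δ | ∃ (q : Q) (a : α) (l r : Q), q ≠ top ∧ l ≠ top ∧ r ≠ top ∧
        (q, a, l, top) ∈ A.Δ ∧ (q, a, top, r) ∈ A.Δ ∧ δ = (q, a, l, r)} ∪
    {δ | ∃ a : α, δ = (top, a, top, top)}

end TreeAutomaton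

/-! Runs are strategies. Away from `top`, acceptance of `t` is a parity game: at a disjunctive
transition the first player chooses the direction, at a conjunctive one the opponent does, and `top`
may be forgotten because any subtree sent to `top` can be filled with an accepting run. Dualising
swaps ownership, and adding one to every priority swaps the winning condition.

The languages are disjoint because accepting runs of both automata from one state share a branch
avoiding `top`, whose priorities differ by exactly one (`disjoint_language_dual`). They cover all
trees by positional determinacy (`ParityGame.determined`): a strategy winning for either player is
turned into an accepting run of the corresponding automaton (`mem_language_of_winsFrom`).
Determinacy comes from nested fixed points, with least ones for bad priorities and greatest ones for
good priorities. Complementation exchanges the two kinds, and strategies are extracted by induction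
on the nesting depth.

The counting claims only concern a shift by one and the choice of `e`. -/

/-- The maximal value that the sequence takes infinitely often exists and satisfies `p`. -/
def LimsupSatisfies (p : ℕ → Prop) (c : ℕ → ℕ) : Prop :=
  ∃ m : ℕ, p m ∧ (∃ᶠ i in Filter.atTop, c i = m) ∧
    ∀ k : ℕ, (∃ᶠ i in Filter.atTop, c i = k) → k ≤ m

theorem frequently_shift (q : ℕ → Prop) (N : ℕ) :
    (∃ᶠ i in Filter.atTop, q (i + N)) ↔ ∃ᶠ i in Filter.atTop, q i := by
  conv_rhs => rw [← Filter.map_add_atTop_eq_nat N, Filter.frequently_map]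

theorem limsupSatisfies_shift (p : ℕ → Prop) (c : ℕ → ℕ) (N : ℕ) :
    LimsupSatisfies p (fun i => c (i + N)) ↔ LimsupSatisfies p c := by
  simp only [LimsupSatisfies, fun m => frequently_shift (fun i => c i = m) N]

theorem parityAccepting_shift (c : ℕ → ℕ) (N : ℕ) :
    ParityAccepting (fun i => c (i + N)) ↔ ParityAccepting c :=
  limsupSatisfies_shift Even c N

theorem exists_frequently_eq_of_bounded (c : ℕ → ℕ) (n : ℕ) (hc : ∀ i, c i ≤ n) :
    ∃ m, (∃ᶠ i in Filter.atTop, c i = m) ∧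
      ∀ k : ℕ, (∃ᶠ i in Filter.atTop, c i = k) → k ≤ m := by
  have hbound : ∀ k, (∃ᶠ i in Filter.atTop, c i = k) → k ≤ n := fun k hk => by
    obtain ⟨i, hi⟩ := hk.exists
    exact hi ▸ hc i
  have hne : ∃ m, ∃ᶠ i in Filter.atTop, c i = m := by
    by_contra! h
    have hall : ∀ᶠ i in Filter.atTop, ∀ m ∈ Finset.range (n + 1), c i ≠ m :=
      (Filter.eventually_all_finset _).2 fun m _ => h m
    obtain ⟨i, hi⟩ := hall.exists
    exact hi (c i) (Finset.mem_range.2 (Nat.lt_succ_of_le (hc i))) rfl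
  classical
  obtain ⟨m₀, hm₀⟩ := hne
  refine ⟨Nat.findGreatest (fun m => ∃ᶠ i in Filter.atTop, c i = m) n, ?_, fun k hk => ?_⟩
  · exact Nat.findGreatest_spec (P := fun m => ∃ᶠ i in Filter.atTop, c i = m) (hbound m₀ hm₀) hm₀
  · exact Nat.le_findGreatest (hbound k hk) hk

/-! ### Positional determinacy of parity games -/

/-- A two-player parity game in which every position has one move in each direction.  The first
player moves at the positions in `own` and wins a play if the maximal priority seen infinitely
often is in `good`. -/
structure ParityGame (V : Type*) where
  next : V → Dir → V
  own : V → Prop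
  prio : V → ℕ
  good : ℕ → Prop

namespace ParityGame

variable {V : Type*}

/-- The game with the roles of the players exchanged. -/
def dual (G : ParityGame V) : ParityGame V where
  next := G.next
  own v := ¬ G.own v
  prio := G.prio
  good m := ¬ G.good m

/-- `w` can follow `v` if the first player uses the positional strategy `σ`. -/
def Step (G : ParityGame V) (σ : V → Dir) (v w : V) : Prop :=
  ∃ d, (G.own v → d = σ v) ∧ w = G.next v d

/-- The positional strategy `σ` wins from `v`. -/
def WinsFrom (G : ParityGame V) (σ : V → Dir) (v : V) : Prop :=
  ∀ π : ℕ → V, π 0 = v → (∀ i, G.Step σ (π i) (π (i + 1))) →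
    LimsupSatisfies G.good (fun i => G.prio (π i))

/-- The positions from which the first player can force the next position to be in `S`. -/
def force (G : ParityGame V) (S : Set V) : Set V :=
  {v | ∃ d₀, ∀ d, (G.own v → d = d₀) → G.next v d ∈ S}

theorem force_mono (G : ParityGame V) : Monotone G.force :=
  fun _ _ h _ ⟨d₀, hd⟩ => ⟨d₀, fun d hd' => h (hd d hd')⟩

theorem compl_force (G : ParityGame V) (S : Set V) : (G.force S)ᶜ = G.dual.force Sᶜ := by
  ext v
  simp only [force, dual, Set.mem_compl_iff, Set.mem_ofPred_eq]
  by_cases h : G.own v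
  · simpa [h] using fun _ => ⟨Dir.left⟩
  · simp only [h, false_imp_iff, true_imp_iff, not_false_eq_true]
    constructor
    · intro h'
      by_contra! hc
      exact h' ⟨.left, fun d => by simpa using hc d⟩
    · rintro ⟨d, hd⟩ ⟨_, h'⟩
      exact hd d rfl (h' d)

open Classical in
/-- The nested fixed point describing the positions from which the first player can either win
by seeing only priorities below `k`, or make sure that the first position of a priority `j ≥ k`
is followed by a position in `X j`. -/
noncomputable def region (G : ParityGame V) : ℕ → (ℕ → Set V) → Set V
  | 0, X => {v | v ∈ G.force (X (G.prio v))}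
  | k + 1, X =>
      if G.good k then sSup {Y : Set V | Y ≤ region G k (Function.update X k Y)}
      else sInf {Y : Set V | region G k (Function.update X k Y) ≤ Y}

theorem region_mono (G : ParityGame V) (k : ℕ) : Monotone (G.region k) := by
  induction k with
  | zero => exact fun X X' h v hv => G.force_mono (h _) hv
  | succ k ih =>
    intro X X' h
    have hu : ∀ Y, G.region k (Function.update X k Y) ≤ G.region k (Function.update X' k Y) :=
      fun Y => ih (update_le_update_iff.2 ⟨le_rfl, fun j _ => h j⟩)
    unfold region
    split_ifs
    · exact sSup_le_sSup fun Y hY => le_trans hY (hu Y)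
    · exact sInf_le_sInf fun Y hY => le_trans (hu Y) hY

/-- `region k`, as a function of the `k`-th set. -/
noncomputable def regionHom (G : ParityGame V) (k : ℕ) (X : ℕ → Set V) : Set V →o Set V where
  toFun Y := G.region k (Function.update X k Y)
  monotone' _ _ h := G.region_mono k (Function.update_mono h)

theorem region_succ_of_good (G : ParityGame V) {k : ℕ} (hk : G.good k) (X : ℕ → Set V) :
    G.region (k + 1) X = (G.regionHom k X).gfp := by
  rw [region, if_pos hk]; rfl

theorem region_succ_of_not_good (G : ParityGame V) {k : ℕ} (hk : ¬ G.good k) (X : ℕ → Set V) :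
    G.region (k + 1) X = (G.regionHom k X).lfp := by
  rw [region, if_neg hk]; rfl

theorem compl_update (X : ℕ → Set V) (k : ℕ) (Y : Set V) :
    (fun j => (Function.update X k Y j)ᶜ) = Function.update (fun j => (X j)ᶜ) k Yᶜ := by
  ext j : 1
  by_cases h : j = k
  · subst h; simp
  · simp [h]

/-- De Morgan duality: complementing exchanges least and greatest fixed points, just as exchanging
the players exchanges good and bad priorities. Hence a position outside the region of one player
lies in that of the other. -/
theorem compl_region (G : ParityGame V) (k : ℕ) (X : ℕ → Set V) :
    (G.region k X)ᶜ = G.dual.region k (fun j => (X j)ᶜ) := by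
  induction k generalizing X with
  | zero =>
    ext v
    exact Set.ext_iff.1 (G.compl_force (X (G.prio v))) v
  | succ k ih =>
    have hY : ∀ Y, G.dual.region k (Function.update (fun j => (X j)ᶜ) k Yᶜ) =
        (G.region k (Function.update X k Y))ᶜ := fun Y => by rw [ih, compl_update]
    by_cases hk : G.good k
    · have hk' : ¬ G.dual.good k := not_not.2 hk
      unfold region
      rw [if_pos hk, if_neg hk', compl_sSup']
      congr 1
      ext Y
      constructor
      · rintro ⟨Z, hZ, rfl⟩
        exact (hY Z).le.trans (compl_le_compl hZ)
      · intro h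
        refine ⟨Yᶜ, ?_, compl_compl Y⟩
        have := hY Yᶜ
        rw [compl_compl] at this
        rw [Set.mem_ofPred_eq, this] at h
        exact compl_le_iff_compl_le.1 h
    · have hk' : G.dual.good k := hk
      unfold region
      rw [if_neg hk, if_pos hk', compl_sInf']
      congr 1
      ext Y
      constructor
      · rintro ⟨Z, hZ, rfl⟩
        exact (compl_le_compl hZ).trans (hY Z).ge
      · intro h
        refine ⟨Yᶜ, ?_, compl_compl Y⟩
        have := hY Yᶜ
        rw [compl_compl] at this
        rw [Set.mem_ofPred_eq, this] at h
        exact le_compl_comm.1 h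

/-- `σ` does what `region k X` promises: it stays in the region until a priority `j ≥ k` is
followed by a position in `X j`, and it wins if this never happens. -/
structure Realises (G : ParityGame V) (k : ℕ) (X : ℕ → Set V) (σ : V → Dir) : Prop where
  stay : ∀ v ∈ G.region k X, ∀ w, G.Step σ v w → G.prio v < k → w ∈ G.region k X
  exit : ∀ v ∈ G.region k X, ∀ w, G.Step σ v w → k ≤ G.prio v → w ∈ X (G.prio v)
  wins : ∀ π : ℕ → V, (∀ i, π i ∈ G.region k X) → (∀ i, G.prio (π i) < k) →
    (∀ i, G.Step σ (π i) (π (i + 1))) → LimsupSatisfies G.good (fun i => G.prio (π i))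

/-- The greatest fixed point is its own unfolding, so the inner strategy can be used unchanged.
Either `k` recurs forever and is the maximal recurring priority, or from some point on only
priorities below `k` occur and the inner strategy wins that suffix. -/
theorem Realises.succ_of_good {G : ParityGame V} {k : ℕ} {X : ℕ → Set V} {σ : V → Dir}
    (hk : G.good k)
    (h : G.Realises k (Function.update X k (G.region (k + 1) X)) σ) :
    G.Realises (k + 1) X σ := by
  have hS : G.region k (Function.update X k (G.region (k + 1) X)) = G.region (k + 1) X := by
    rw [G.region_succ_of_good hk]
    exact (G.regionHom k X).map_gfp
  obtain ⟨h₁, h₂, h₃⟩ := h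
  rw [hS] at h₁ h₂ h₃
  refine ⟨fun v hv w hw hlt => ?_, fun v hv w hw hle => ?_, fun π hπ hc hs => ?_⟩
  · rcases Nat.lt_succ_iff_lt_or_eq.1 hlt with h | h
    · exact h₁ v hv w hw h
    · simpa [h] using h₂ v hv w hw h.ge
  · have := h₂ v hv w hw (Nat.le_of_succ_le hle)
    rwa [Function.update_of_ne (by omega)] at this
  · by_cases hf : ∃ᶠ i in Filter.atTop, G.prio (π i) = k
    · refine ⟨k, hk, hf, fun j hj => ?_⟩
      obtain ⟨i, rfl⟩ := hj.exists
      exact Nat.lt_succ_iff.1 (hc i)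
    · rw [Filter.not_frequently, Filter.eventually_atTop] at hf
      obtain ⟨N, hN⟩ := hf
      rw [← limsupSatisfies_shift _ _ N]
      refine h₃ (fun i => π (i + N)) (fun i => hπ _) (fun i => ?_) (fun i => ?_)
      · have h1 := hc (i + N)
        have h2 := hN (i + N) (by omega)
        show G.prio (π (i + N)) < k
        omega
      · have := hs (i + N)
        rwa [show i + N + 1 = i + 1 + N by omega] at this

open OrdinalApprox in
-- The strict inequality `b < a` is what makes ranks drop below.
theorem mem_lfpApprox_bot {f : Set V →o Set V} {a : Ordinal} {v : V} :
    v ∈ lfpApprox f ⊥ a ↔ ∃ b < a, v ∈ f (lfpApprox f ⊥ b) := by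
  rw [lfpApprox]
  simp

open OrdinalApprox in
-- Rank the positions of the least fixed point by the stage at which they enter, and at each
-- position play the inner strategy for its rank. The rank never increases and drops at every visit
-- to `k`, so `k` is seen only finitely often.
theorem exists_realises_succ_of_not_good {G : ParityGame V} {k : ℕ} {X : ℕ → Set V}
    (hk : ¬ G.good k) (h : ∀ Y, ∃ σ, G.Realises k (Function.update X k Y) σ) :
    ∃ σ, G.Realises (k + 1) X σ := by
  set f := G.regionHom k X with hf
  choose τ hτ using h
  set A : Ordinal → Set V := fun a => lfpApprox f ⊥ a with hA
  have hlfp : ∀ {v}, v ∈ f.lfp ↔ ∃ a, v ∈ f (A a) := by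
    intro v
    constructor
    · intro hv
      obtain ⟨o, ho⟩ := lfp_mem_range_lfpApprox f
      rw [← ho] at hv
      obtain ⟨b, -, hb⟩ := mem_lfpApprox_bot.1 hv
      exact ⟨b, hb⟩
    · rintro ⟨a, ha⟩
      have : A a ≤ f.lfp := lfpApprox_le_of_mem_fixedPoints f f.isFixedPt_lfp bot_le a
      rw [← f.map_lfp]
      exact f.monotone this ha
  -- Outside the least fixed point the infimum is over the empty set; that value is never used.
  let r : V → Ordinal := fun v => sInf {a | v ∈ f (A a)}
  have hr : ∀ v ∈ f.lfp, v ∈ f (A (r v)) := fun v hv => csInf_mem (s := {a | v ∈ f (A a)}) (hlfp.1 hv)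
  have hrle : ∀ {v a}, v ∈ f (A a) → r v ≤ a := fun {v a} h => csInf_le' (s := {a | v ∈ f (A a)}) h
  have hstep : ∀ {v w}, G.Step (fun v => τ (A (r v)) v) v w → G.Step (τ (A (r v))) v w := id
  have hlt : ∀ v ∈ f.lfp, ∀ w, G.Step (fun v => τ (A (r v)) v) v w → G.prio v < k →
      w ∈ f (A (r v)) :=
    fun v hv w hw hp => (hτ (A (r v))).stay v (hr v hv) w (hstep hw) hp
  have heq : ∀ v ∈ f.lfp, ∀ w, G.Step (fun v => τ (A (r v)) v) v w → G.prio v = k →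
      w ∈ A (r v) := by
    intro v hv w hw hp
    have := (hτ (A (r v))).exit v (hr v hv) w (hstep hw) hp.ge
    rwa [hp, Function.update_self] at this
  refine ⟨fun v => τ (A (r v)) v, ?_, ?_, ?_⟩
  · rw [G.region_succ_of_not_good hk]
    intro v hv w hw hp
    rcases Nat.lt_succ_iff_lt_or_eq.1 hp with h | h
    · exact hlfp.2 ⟨_, hlt v hv w hw h⟩
    · obtain ⟨b, -, hb⟩ := mem_lfpApprox_bot.1 (heq v hv w hw h)
      exact hlfp.2 ⟨b, hb⟩
  · rw [G.region_succ_of_not_good hk]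
    intro v hv w hw hle
    have := (hτ (A (r v))).exit v (hr v hv) w (hstep hw) (by omega)
    rwa [Function.update_of_ne (by omega)] at this
  · rw [G.region_succ_of_not_good hk]
    intro π hπ hc hs
    have hdrop : ∀ i, G.prio (π i) = k → r (π (i + 1)) < r (π i) := fun i hi => by
      obtain ⟨b, hb, hb'⟩ := mem_lfpApprox_bot.1 (heq _ (hπ i) _ (hs i) hi)
      exact (hrle hb').trans_lt hb
    have hanti : Antitone fun i => r (π i) := antitone_nat_of_succ_le fun i => by
      rcases Nat.lt_succ_iff_lt_or_eq.1 (hc i) with h | h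
      · exact hrle (hlt _ (hπ i) _ (hs i) h)
      · exact (hdrop i h).le
    -- From a minimum of the rank onwards the rank is constant, so priority `k` no longer occurs and
    -- the play follows one single inner strategy.
    set N := Function.argmin fun i => r (π i) with hN
    have hconst : ∀ i, r (π (i + N)) = r (π N) := fun i =>
      le_antisymm (hanti (Nat.le_add_left N i))
        (Function.argmin_le (fun i => r (π i)) (i + N))
    rw [← limsupSatisfies_shift _ _ N]
    refine (hτ (A (r (π N)))).wins (fun i => π (i + N)) (fun i => ?_) (fun i => ?_) (fun i => ?_)
    · have := hr _ (hπ (i + N))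
      rwa [hconst] at this
    · refine (Nat.lt_succ_iff_lt_or_eq.1 (hc (i + N))).resolve_right fun h => ?_
      have h1 := hdrop (i + N) h
      rw [show i + N + 1 = i + 1 + N by omega, hconst, hconst] at h1
      exact lt_irrefl _ h1
    · have := hstep (hs (i + N))
      rw [hconst] at this
      rwa [show i + N + 1 = i + 1 + N by omega] at this

theorem exists_realises (G : ParityGame V) (k : ℕ) (X : ℕ → Set V) :
    ∃ σ, G.Realises k X σ := by
  induction k generalizing X with
  | zero =>
    have h : ∀ v, ∃ d₀, v ∈ G.region 0 X →
        ∀ d, (G.own v → d = d₀) → G.next v d ∈ X (G.prio v) := fun v => by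
      by_cases hv : v ∈ G.region 0 X
      · exact hv.imp fun d₀ h _ => h
      · exact ⟨.left, fun h => absurd h hv⟩
    choose σ hσ using h
    refine ⟨σ, fun _ _ _ _ h => absurd h (Nat.not_lt_zero _), ?_,
      fun _ _ h => absurd (h 0) (Nat.not_lt_zero _)⟩
    rintro v hv w ⟨d, hd, rfl⟩ -
    exact hσ v hv d hd
  | succ k ih =>
    by_cases hk : G.good k
    · exact (ih _).imp fun σ h => h.succ_of_good hk
    · exact exists_realises_succ_of_not_good hk fun Y => ih _

theorem exists_winsFrom_of_mem_region (G : ParityGame V) (n : ℕ) (hn : ∀ v, G.prio v < n)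
    (X : ℕ → Set V) {v : V} (hv : v ∈ G.region n X) : ∃ σ, G.WinsFrom σ v := by
  obtain ⟨σ, hσ⟩ := G.exists_realises n X
  refine ⟨σ, fun π h0 hs => hσ.wins π (fun i => ?_) (fun i => hn _) hs⟩
  induction i with
  | zero => exact h0 ▸ hv
  | succ i ih => exact hσ.stay _ ih _ (hs i) (hn _)

/-- Positional determinacy of parity games with bounded priorities. -/
theorem determined (G : ParityGame V) (n : ℕ) (hn : ∀ v, G.prio v < n) (v : V) :
    (∃ σ, G.WinsFrom σ v) ∨ ∃ σ, G.dual.WinsFrom σ v := by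
  -- All priorities are below `n`, so no exit set is ever consulted; any choice would do.
  by_cases hv : v ∈ G.region n fun _ => ∅
  · exact Or.inl (G.exists_winsFrom_of_mem_region n hn _ hv)
  · refine Or.inr (G.dual.exists_winsFrom_of_mem_region n hn (fun _ => ∅ᶜ) ?_)
    rw [← G.compl_region n]
    exact hv

end ParityGame

/-! ### Branches and priorities shifted by one -/

theorem branchNode_succ (d : ℕ → Dir) (i : ℕ) : branchNode d (i + 1) = branchNode d i ++ [d i] := by
  simp [branchNode, List.range_succ]

theorem branchNode_succ' (d : ℕ → Dir) (i : ℕ) :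
    branchNode d (i + 1) = d 0 :: branchNode (fun n => d (n + 1)) i := by
  rw [branchNode, List.range_succ_eq_map, List.map_cons, List.map_map]
  rfl

theorem limsupSatisfies_even_succ {c : ℕ → ℕ} (h : LimsupSatisfies (fun m => ¬ Even m) c) :
    ParityAccepting (fun i => c i + 1) := by
  obtain ⟨m, hm, hf, hmax⟩ := h
  refine ⟨m + 1, Nat.even_add_one.2 hm, by simpa using hf, fun k hk => ?_⟩
  obtain ⟨i, hi⟩ := hk.exists
  obtain ⟨j, rfl⟩ : ∃ j, k = j + 1 := ⟨c i, hi.symm⟩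
  exact Nat.succ_le_succ (hmax j (by simpa using hk))

theorem not_parityAccepting_succ {c : ℕ → ℕ} (h : ParityAccepting c) :
    ¬ ParityAccepting (fun i => c i + 1) := by
  rintro ⟨m', he', hf', hmax'⟩
  obtain ⟨m, he, hf, hmax⟩ := h
  obtain ⟨i, hi⟩ := hf'.exists
  obtain ⟨j, rfl⟩ : ∃ j, m' = j + 1 := ⟨c i, hi.symm⟩
  have h1 := hmax j (by simpa using hf')
  have h2 := hmax' (m + 1) (by simpa using hf)
  obtain rfl : m = j := by omega
  exact Nat.even_add_one.1 he' he

theorem parityAccepting_of_even {c : ℕ → ℕ} (n : ℕ) (hn : ∀ i, c i ≤ n) (he : ∀ i, Even (c i)) :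
    ParityAccepting c := by
  obtain ⟨m, hf, hmax⟩ := exists_frequently_eq_of_bounded c n hn
  obtain ⟨i, hi⟩ := hf.exists
  exact ⟨m, hi ▸ he i, hf, hmax⟩

/-! ### Transitions of a game automaton and of its dual -/

namespace TreeAutomaton

variable {α Q : Type*}

/-- The transitions from the states other than `top` lead along `move` to states other than `top`,
and they are disjunctive exactly where `disj` holds. -/
structure HasMoves (A : TreeAutomaton α Q) (top : Q)
    (move : {q // q ≠ top} → α → Dir → {q // q ≠ top}) (disj : {q // q ≠ top} → α → Prop) :
    Prop where
  of_disj : ∀ q a, disj q a → A.transFrom q a =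
    {((q : Q), a, (move q a .left : Q), top), ((q : Q), a, top, (move q a .right : Q))}
  of_not_disj : ∀ q a, ¬ disj q a → A.transFrom q a =
    {((q : Q), a, (move q a .left : Q), (move q a .right : Q))}

theorem IsGame.exists_hasMoves {A : TreeAutomaton α Q} {top : Q} (hA : A.IsGame top) :
    ∃ move disj, A.HasMoves top move disj := by
  have h : ∀ (q : {q // q ≠ top}) (a : α), ∃ (m : Dir → {q // q ≠ top}) (P : Prop),
      (P → A.transFrom q a = {((q : Q), a, (m .left : Q), top), ((q : Q), a, top, (m .right : Q))}) ∧
      (¬ P → A.transFrom q a = {((q : Q), a, (m .left : Q), (m .right : Q))}) := by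
    intro q a
    rcases hA.conj_or_disj q q.2 a with ⟨l, r, hl, hr, h⟩ | ⟨l, r, hl, hr, h⟩
    · exact ⟨fun d => Dir.casesOn d ⟨l, hl⟩ ⟨r, hr⟩, False, False.elim, fun _ => h⟩
    · exact ⟨fun d => Dir.casesOn d ⟨l, hl⟩ ⟨r, hr⟩, True, fun _ => h, fun h => (h trivial).elim⟩
  choose move disj h₁ h₂ using h
  exact ⟨move, disj, h₁, h₂⟩

section Transitions

variable {A : TreeAutomaton α Q} {top : Q} {move : {q // q ≠ top} → α → Dir → {q // q ≠ top}}
  {disj : {q // q ≠ top} → α → Prop}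

theorem mem_transFrom {q : Q} {a : α} {x y : Q} :
    (q, a, x, y) ∈ A.transFrom q a ↔ (q, a, x, y) ∈ A.Δ := by
  simp [transFrom]

theorem HasMoves.mem_iff_of_disj (hm : A.HasMoves top move disj) {q : {q // q ≠ top}} {a : α}
    (h : disj q a) {x y : Q} : ((q : Q), a, x, y) ∈ A.Δ ↔
      (x = move q a .left ∧ y = top) ∨ (x = top ∧ y = move q a .right) := by
  rw [← mem_transFrom, hm.of_disj q a h]
  simp

theorem HasMoves.mem_iff_of_not_disj (hm : A.HasMoves top move disj) {q : {q // q ≠ top}} {a : α}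
    (h : ¬ disj q a) {x y : Q} : ((q : Q), a, x, y) ∈ A.Δ ↔
      x = move q a .left ∧ y = move q a .right := by
  rw [← mem_transFrom, hm.of_not_disj q a h]
  simp

theorem dual_Ω_of_ne (e : ℕ) {q : Q} (hq : q ≠ top) : (A.dual top e).Ω q = A.Ω q + 1 := by
  simp [dual, hq]

theorem dual_Ω_top (e : ℕ) : (A.dual top e).Ω top = e := by
  simp [dual]

theorem mem_dual_iff (e : ℕ) (q : {q // q ≠ top}) (a : α) (x y : Q) :
    ((q : Q), a, x, y) ∈ (A.dual top e).Δ ↔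
      (∃ l r, l ≠ top ∧ r ≠ top ∧ ((q : Q), a, l, r) ∈ A.Δ ∧
        ((x = l ∧ y = top) ∨ (x = top ∧ y = r))) ∨
      ((q : Q), a, x, top) ∈ A.Δ ∧ ((q : Q), a, top, y) ∈ A.Δ ∧ x ≠ top ∧ y ≠ top := by
  constructor
  · rintro ((⟨_, _, l, r, -, hl, hr, hΔ, h | h⟩ | ⟨_, _, l, r, -, hl, hr, h₁, h₂, h⟩) | ⟨_, h⟩)
    · cases h
      exact Or.inl ⟨_, _, hl, hr, hΔ, Or.inl ⟨rfl, rfl⟩⟩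
    · cases h
      exact Or.inl ⟨_, _, hl, hr, hΔ, Or.inr ⟨rfl, rfl⟩⟩
    · cases h
      exact Or.inr ⟨h₁, h₂, hl, hr⟩
    · exact absurd (congrArg Prod.fst h) q.2
  · rintro (⟨l, r, hl, hr, hΔ, ⟨rfl, rfl⟩ | ⟨rfl, rfl⟩⟩ | ⟨h₁, h₂, hl, hr⟩)
    · exact Or.inl (Or.inl ⟨q, a, _, r, q.2, hl, hr, hΔ, Or.inl rfl⟩)
    · exact Or.inl (Or.inl ⟨q, a, l, _, q.2, hl, hr, hΔ, Or.inr rfl⟩)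
    · exact Or.inl (Or.inr ⟨q, a, x, y, q.2, hl, hr, h₁, h₂, rfl⟩)

theorem mem_transFrom_iff {q q' : Q} {a a' : α} {x y : Q} :
    (q', a', x, y) ∈ A.transFrom q a ↔ (q, a, x, y) ∈ A.Δ ∧ q' = q ∧ a' = a := by
  constructor
  · rintro ⟨h, rfl, rfl⟩
    exact ⟨h, rfl, rfl⟩
  · rintro ⟨h, rfl, rfl⟩
    exact ⟨h, rfl, rfl⟩

theorem HasMoves.dual (hm : A.HasMoves top move disj) (e : ℕ) :
    (A.dual top e).HasMoves top move (fun q a => ¬ disj q a) := by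
  constructor
  · rintro q a h
    have hl := (move q a .left).2
    have hr := (move q a .right).2
    ext ⟨q', a', x, y⟩
    simp only [mem_transFrom_iff, mem_dual_iff, hm.mem_iff_of_not_disj h, Set.mem_insert_iff,
      Set.mem_singleton_iff, Prod.mk.injEq]
    constructor
    · grind
    · intro h'
      exact ⟨Or.inl ⟨_, _, hl, hr, ⟨rfl, rfl⟩, by tauto⟩, by tauto, by tauto⟩
  · rintro q a h
    have hl := (move q a .left).2
    have hr := (move q a .right).2
    ext ⟨q', a', x, y⟩
    simp only [mem_transFrom_iff, mem_dual_iff, hm.mem_iff_of_disj (not_not.1 h),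
      Set.mem_singleton_iff, Prod.mk.injEq]
    grind

theorem language_dual_top (A : TreeAutomaton α Q) (top : Q) {e : ℕ} (he : Even e) :
    ((A.dual top e).withInit top).language = Set.univ := by
  refine Set.eq_univ_of_forall fun t => ⟨fun _ => top, ⟨rfl, fun u => Or.inr ⟨t u, rfl⟩⟩, fun d => ?_⟩
  refine parityAccepting_of_even e (fun i => ?_) (fun i => ?_)
  · exact (dual_Ω_top e).le
  · exact (dual_Ω_top (A := A) (top := top) e).symm ▸ he

theorem isGame_of_hasMoves (hm : A.HasMoves top move disj) (h₁ : top ≠ A.init)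
    (h₂ : (A.withInit top).language = Set.univ) : A.IsGame top := by
  refine ⟨h₁, h₂, fun q hq a => ?_⟩
  by_cases h : disj ⟨q, hq⟩ a
  · exact Or.inr ⟨_, _, (move ⟨q, hq⟩ a .left).2, (move ⟨q, hq⟩ a .right).2, hm.of_disj ⟨q, hq⟩ a h⟩
  · exact Or.inl ⟨_, _, (move ⟨q, hq⟩ a .left).2, (move ⟨q, hq⟩ a .right).2, hm.of_not_disj ⟨q, hq⟩ a h⟩

/-- Two accepting runs, one of the automaton and one of its dual, share a branch that avoids `top`. -/
theorem disjoint_language_dual (hm : A.HasMoves top move disj) (e : ℕ) {q : Q} (hq : q ≠ top)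
    {t : LTree α} (h : t ∈ (A.withInit q).language) :
    t ∉ ((A.dual top e).withInit q).language := by
  rintro ⟨ρ', ⟨hr0', hr'⟩, hacc'⟩
  obtain ⟨ρ, ⟨hr0, hr⟩, hacc⟩ := h
  have hm' := hm.dual e
  -- At a common state and letter, exactly one of the two automata is disjunctive. The direction its
  -- run keeps in the game is also followed by the conjunctive run, so the two agree on that child.
  have hstep : ∀ u, ∃ d, ρ u = ρ' u → ρ u ≠ top → ρ (u ++ [d]) = ρ' (u ++ [d]) ∧ ρ (u ++ [d]) ≠ top := by
    intro u
    by_cases hu : ρ u = ρ' u ∧ ρ u ≠ top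
    · obtain ⟨hu, hne⟩ := hu
      obtain ⟨s, hs⟩ : ∃ s : {q // q ≠ top}, (s : Q) = ρ u := ⟨⟨_, hne⟩, rfl⟩
      have h1 : ((s : Q), t u, _, _) ∈ A.Δ := hs ▸ hr u
      have h2 : ((s : Q), t u, _, _) ∈ (A.dual top e).Δ := (hs.trans hu) ▸ hr' u
      by_cases hd : disj s (t u)
      · obtain ⟨hl, hr⟩ := (hm'.mem_iff_of_not_disj (not_not.2 hd)).1 h2
        rcases (hm.mem_iff_of_disj hd).1 h1 with ⟨hx, -⟩ | ⟨-, hx⟩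
        · exact ⟨.left, fun _ _ => ⟨hx.trans hl.symm, ne_of_eq_of_ne hx (move s (t u) _).2⟩⟩
        · exact ⟨.right, fun _ _ => ⟨hx.trans hr.symm, ne_of_eq_of_ne hx (move s (t u) _).2⟩⟩
      · obtain ⟨hl, hr⟩ := (hm.mem_iff_of_not_disj hd).1 h1
        rcases (hm'.mem_iff_of_disj hd).1 h2 with ⟨hx, -⟩ | ⟨-, hx⟩
        · exact ⟨.left, fun _ _ => ⟨hl.trans hx.symm, ne_of_eq_of_ne hl (move s (t u) _).2⟩⟩
        · exact ⟨.right, fun _ _ => ⟨hr.trans hx.symm, ne_of_eq_of_ne hr (move s (t u) _).2⟩⟩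
    · exact ⟨.left, fun h1 h2 => absurd ⟨h1, h2⟩ hu⟩
  choose δ hδ using hstep
  let node : ℕ → List Dir := fun i => Nat.rec [] (fun _ u => u ++ [δ u]) i
  let d : ℕ → Dir := fun i => δ (node i)
  have hnode : ∀ i, branchNode d i = node i := fun i => by
    induction i with
    | zero => rfl
    | succ i ih => rw [branchNode_succ, ih]
  have hinv : ∀ i, ρ (node i) = ρ' (node i) ∧ ρ (node i) ≠ top := fun i => by
    induction i with
    | zero => exact ⟨hr0.trans hr0'.symm, fun h => hq (hr0.symm.trans h)⟩
    | succ i ih => exact hδ _ ih.1 ih.2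
  refine not_parityAccepting_succ (hacc d) ?_
  convert hacc' d using 2 with i
  rw [hnode, ← (hinv i).1]
  exact (dual_Ω_of_ne e (hinv i).2).symm

end Transitions

/-! ### From winning strategies to accepting runs -/

/-- The acceptance game of `A` over `t`, restricted to the states other than `top`. -/
def acceptanceGame (A : TreeAutomaton α Q) (top : Q)
    (move : {q // q ≠ top} → α → Dir → {q // q ≠ top}) (disj : {q // q ≠ top} → α → Prop)
    (t : LTree α) : ParityGame (List Dir × {q // q ≠ top}) where
  next v d := (v.1 ++ [d], move v.2 (t v.1) d)
  own v := disj v.2 (t v.1)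
  prio v := A.Ω v.2
  good := Even

/-- `ρ` is the part below `u` of an accepting run over `t`. -/
structure IsTail (A : TreeAutomaton α Q) (t : LTree α) (u : List Dir) (ρ : LTree Q) : Prop where
  trans : ∀ w, (ρ w, t (u ++ w), ρ (w ++ [Dir.left]), ρ (w ++ [Dir.right])) ∈ A.Δ
  accepting : A.IsAccepting ρ

theorem IsTail.child {A : TreeAutomaton α Q} {t : LTree α} {u : List Dir} {ρ : LTree Q}
    (h : A.IsTail t u ρ) (d : Dir) : A.IsTail t (u ++ [d]) (fun w => ρ (d :: w)) := by
  refine ⟨fun w => by simpa using h.trans (d :: w), fun b => ?_⟩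
  -- The branch is `d` followed by `b`; its first priority does not affect acceptance.
  have := (parityAccepting_shift _ 1).2 (h.accepting fun n => Nat.casesOn n d b)
  simp only [branchNode_succ'] at this
  exact this

theorem exists_isTail {A : TreeAutomaton α Q} {top : Q}
    (htop : (A.withInit top).language = Set.univ) (t : LTree α) (u : List Dir) :
    ∃ ρ, ρ [] = top ∧ A.IsTail t u ρ := by
  have h : (fun w => t (u ++ w)) ∈ (A.withInit top).language := htop ▸ Set.mem_univ _
  obtain ⟨ρ, ⟨h0, hr⟩, hacc⟩ := h
  exact ⟨ρ, h0, hr, hacc⟩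

/-- The mode in which a run induced by a strategy visits a node: either in a state of the acceptance
game, or as the root of a part of another run. -/
inductive Mode (Q : Type*) (top : Q) where
  | game (q : {q // q ≠ top})
  | tail (ρ : LTree Q)

/-- The state in which a node is visited. -/
def Mode.state {top : Q} : Mode Q top → Q
  | .game q => q
  | .tail ρ => ρ []

section Induced

variable (top : Q) (move : {q // q ≠ top} → α → Dir → {q // q ≠ top})
  (disj : {q // q ≠ top} → α → Prop) (t : LTree α) (σ : List Dir × {q // q ≠ top} → Dir)
  (R : List Dir → LTree Q)

open Classical in
/-- The mode of the child of `u` in direction `d`. -/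
noncomputable def nextMode (u : List Dir) (d : Dir) : Mode Q top → Mode Q top
  | .game q => if disj q (t u) → d = σ (u, q) then .game (move q (t u) d) else .tail (R (u ++ [d]))
  | .tail ρ => .tail (fun w => ρ (d :: w))

/-- The mode of a node, given by the reversed word of directions. -/
noncomputable def revMode (q : {q // q ≠ top}) : List Dir → Mode Q top
  | [] => .game q
  | d :: r => nextMode top move disj t σ R r.reverse d (revMode q r)

/-- The mode of a node. -/
noncomputable def nodeMode (q : {q // q ≠ top}) (u : List Dir) : Mode Q top :=
  revMode top move disj t σ R q u.reverse

theorem nodeMode_append (q : {q // q ≠ top}) (u : List Dir) (d : Dir) :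
    nodeMode top move disj t σ R q (u ++ [d]) =
      nextMode top move disj t σ R u d (nodeMode top move disj t σ R q u) := by
  simp [nodeMode, revMode]

end Induced

/-- A winning strategy in the acceptance game yields an accepting run. -/
theorem mem_language_of_winsFrom {A : TreeAutomaton α Q} {top : Q}
    {move : {q // q ≠ top} → α → Dir → {q // q ≠ top}} {disj : {q // q ≠ top} → α → Prop}
    (hm : A.HasMoves top move disj) (htop : (A.withInit top).language = Set.univ)
    {t : LTree α} {q : {q // q ≠ top}} {σ : List Dir × {q // q ≠ top} → Dir}
    (hσ : (A.acceptanceGame top move disj t).WinsFrom σ ([], q)) :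
    t ∈ (A.withInit q).language := by
  choose R hR0 hR using exists_isTail htop t
  set μ := nodeMode top move disj t σ R q with hμ
  have hnext : ∀ u d, μ (u ++ [d]) = nextMode top move disj t σ R u d (μ u) :=
    nodeMode_append top move disj t σ R q
  have htail : ∀ u ρ, μ u = .tail ρ → A.IsTail t u ρ := fun u => by
    induction u using List.reverseRecOn with
    | nil => intro ρ h; cases h
    | append_singleton u d ih =>
      intro ρ h
      rw [hnext] at h
      cases hu : μ u with
      | game s =>
        rw [hu, nextMode] at h
        split_ifs at h
        cases h
        exact hR _
      | tail ρ' =>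
        rw [hu, nextMode] at h
        cases h
        exact (ih ρ' hu).child d
  refine ⟨fun u => (μ u).state, ⟨rfl, fun u => ?_⟩, fun d => ?_⟩
  · show ((μ u).state, t u, (μ (u ++ [Dir.left])).state, (μ (u ++ [Dir.right])).state) ∈ A.Δ
    cases hu : μ u with
    | game s =>
      simp only [hnext, hu, nextMode]
      by_cases hd : disj s (t u)
      · refine (hm.mem_iff_of_disj hd).2 ?_
        cases σ (u, s)
        · left; simp [Mode.state, hR0, hd]
        · right; simp [Mode.state, hR0, hd]
      · refine (hm.mem_iff_of_not_disj hd).2 ?_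
        simp [hd, Mode.state]
    | tail ρ =>
      rw [hnext, hnext, hu]
      simpa [Mode.state, nextMode] using (htail u ρ hu).trans []
  · show ParityAccepting fun i => A.Ω (μ (branchNode d i)).state
    -- A branch either enters a grafted run and follows it forever, or stays in the game and is a
    -- play consistent with `σ`.
    by_cases hex : ∃ N ρ, μ (branchNode d N) = .tail ρ
    · obtain ⟨N, ρ, hN⟩ := hex
      have hlater : ∀ i, μ (branchNode d (i + N)) =
          .tail (fun w => ρ (branchNode (fun j => d (j + N)) i ++ w)) := fun i => by
        induction i with
        | zero => simpa [branchNode] using hN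
        | succ i ih =>
          rw [show i + 1 + N = i + N + 1 by omega, branchNode_succ, hnext, ih, nextMode,
            branchNode_succ]
          simp
      rw [← parityAccepting_shift _ N]
      simp only [hlater, Mode.state, List.append_nil]
      exact (htail _ ρ hN).accepting _
    · have hgame : ∀ i, ∃ s, μ (branchNode d i) = .game s := fun i => by
        cases h : μ (branchNode d i) with
        | game s => exact ⟨s, rfl⟩
        | tail ρ => exact absurd ⟨i, ρ, h⟩ hex
      choose s hs using hgame
      have := hσ (fun i => (branchNode d i, s i)) ?_ fun i => ⟨d i, ?_⟩
      · simp only [hs]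
        exact this
      · have h0 : Mode.game q = Mode.game (s 0) := hs 0
        cases h0
        rfl
      · have h1 := hs (i + 1)
        rw [branchNode_succ, hnext, hs i, nextMode] at h1
        split_ifs at h1 with h2
        · exact ⟨h2, Prod.ext (branchNode_succ d i) (Mode.game.inj h1).symm⟩

end TreeAutomaton

/-! ### Complementation and the number of priorities -/

namespace TreeAutomaton

variable {α Q : Type*} {A : TreeAutomaton α Q} {top : Q}

theorem language_dual_withInit [Finite Q] (hA : A.IsGame top) {e : ℕ} (he : Even e) {q : Q}
    (hq : q ≠ top) : ((A.dual top e).withInit q).language = ((A.withInit q).language)ᶜ := by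
  obtain ⟨move, disj, hm⟩ := hA.exists_hasMoves
  ext t
  refine ⟨fun h h' => disjoint_language_dual hm e hq h' h, fun h => ?_⟩
  obtain ⟨n, hn⟩ := (Set.finite_range A.Ω).bddAbove
  rcases (A.acceptanceGame top move disj t).determined (n + 1)
    (fun v => Nat.lt_succ_of_le (hn ⟨_, rfl⟩)) ([], ⟨q, hq⟩) with ⟨σ, hσ⟩ | ⟨σ, hσ⟩
  · exact absurd (mem_language_of_winsFrom hm hA.language_top hσ) h
  -- The dual of the acceptance game and the acceptance game of the dual automaton have the same
  -- moves and owners, so `σ` has the same plays in both; an odd maximal recurring priority becomes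
  -- even after the shift.
  · refine mem_language_of_winsFrom (hm.dual e) (language_dual_top A top he) (q := ⟨q, hq⟩) (σ := σ)
      fun π h0 hs => ?_
    have := limsupSatisfies_even_succ (hσ π h0 hs)
    show ParityAccepting fun i => (A.dual top e).Ω (π i).2
    simp only [fun i => dual_Ω_of_ne (A := A) e (π i).2.2]
    exact this

theorem isGame_dual (hA : A.IsGame top) {e : ℕ} (he : Even e) : (A.dual top e).IsGame top := by
  obtain ⟨move, disj, hm⟩ := hA.exists_hasMoves
  exact isGame_of_hasMoves (hm.dual e) hA.top_ne_init (language_dual_top A top he)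

/-- With only even priorities every play is won, so an arbitrary strategy serves. -/
theorem language_eq_univ_of_even [Finite Q] (hA : A.IsGame top) (h : ∀ q, Even (A.Ω q)) :
    A.language = Set.univ := by
  obtain ⟨move, disj, hm⟩ := hA.exists_hasMoves
  obtain ⟨n, hn⟩ := (Set.finite_range A.Ω).bddAbove
  refine Set.eq_univ_of_forall fun t => ?_
  exact mem_language_of_winsFrom hm hA.language_top (q := ⟨A.init, hA.top_ne_init.symm⟩)
    (σ := fun _ => .left) fun π _ _ =>
      parityAccepting_of_even n (fun i => hn ⟨_, rfl⟩) fun i => h _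

theorem image_dual_Ω (e : ℕ) :
    (A.dual top e).Ω '' {q | q ≠ top} = Nat.succ '' (A.Ω '' {q | q ≠ top}) := by
  rw [Set.image_image]
  exact Set.image_congr fun q hq => dual_Ω_of_ne e hq

theorem ncard_image_dual_Ω (e : ℕ) :
    ((A.dual top e).Ω '' {q | q ≠ top}).ncard = (A.Ω '' {q | q ≠ top}).ncard := by
  rw [image_dual_Ω, Set.ncard_image_of_injective _ Nat.succ_injective]

theorem range_eq_insert_image (f : Q → ℕ) (top : Q) :
    Set.range f = insert (f top) (f '' {q | q ≠ top}) := by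
  rw [← Set.image_insert_eq, ← Set.image_univ]
  congr 1
  ext q
  simp [em]

/-- The priority of `top` either repeats one of another state or is a new one, and `e` has to do
likewise for the shifted priorities. A repeated even `e` needs an odd priority at a state other than
`top`; a fresh one always exists. -/
theorem exists_even_ncard_range_dual_Ω [Finite Q] (h : ∃ q, Odd (A.Ω q)) :
    ∃ e : ℕ, Even e ∧ (Set.range (A.dual top e).Ω).ncard = (Set.range A.Ω).ncard := by
  have hfin : ∀ f : Q → ℕ, (f '' {q | q ≠ top}).Finite := fun f => Set.toFinite _
  by_cases htop : A.Ω top ∈ A.Ω '' {q | q ≠ top}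
  · obtain ⟨q, hq, ho⟩ : ∃ q, q ≠ top ∧ Odd (A.Ω q) := by
      obtain ⟨q, ho⟩ := h
      by_cases hq : q = top
      · obtain ⟨q', hq', he⟩ := htop
        -- If the odd priority is that of `top`, the state sharing it takes over.
        exact ⟨q', hq', by rwa [he, ← hq]⟩
      · exact ⟨q, hq, ho⟩
    refine ⟨A.Ω q + 1, ho.add_one, ?_⟩
    rw [range_eq_insert_image _ top, range_eq_insert_image A.Ω top, Set.insert_eq_of_mem htop,
      Set.insert_eq_of_mem, ncard_image_dual_Ω]
    exact ⟨q, hq, by rw [dual_Ω_of_ne _ hq, dual_Ω_top]⟩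
  · obtain ⟨n, hn⟩ := (Set.finite_range A.Ω).bddAbove
    -- Even, and larger than every shifted priority, these being at most `n + 1`.
    refine ⟨2 * (n + 1), even_two_mul _, ?_⟩
    rw [range_eq_insert_image _ top, range_eq_insert_image A.Ω top,
      Set.ncard_insert_of_notMem htop (hfin _), Set.ncard_insert_of_notMem _ (hfin _),
      ncard_image_dual_Ω]
    rw [dual_Ω_top]
    rintro ⟨q, hq, he⟩
    rw [dual_Ω_of_ne _ hq] at he
    have : A.Ω q ≤ n := hn ⟨q, rfl⟩
    omega

end TreeAutomaton

theorem mainTheorem8 {α Q : Type*} [Finite α] [Nonempty α] [Finite Q]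
    (A : TreeAutomaton α Q) (top : Q) (hA : A.IsGame top) :
    -- every choice of an even priority for `top` gives a game automaton, on the same set of states,
    -- that recognises the complement; and the complementation holds state by state
    (∀ e : ℕ, Even e →
      (A.dual top e).IsGame top ∧
      (A.dual top e).language = A.languageᶜ ∧
      ∀ q : Q, q ≠ top →
        ((A.dual top e).withInit q).language = ((A.withInit q).language)ᶜ) ∧
    -- the number of priorities of the states other than `top` is the same
    (∀ e : ℕ, ((A.dual top e).Ω '' {q | q ≠ top}).ncard = (A.Ω '' {q | q ≠ top}).ncard) ∧
    -- with the priority of `top` counted, it is also the same for a suitable even `e`, except if all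
    -- priorities are even, and then the automaton accepts every tree
    ((∃ q : Q, Odd (A.Ω q)) →
      ∃ e : ℕ, Even e ∧
        (Set.range (A.dual top e).Ω).ncard = (Set.range A.Ω).ncard) ∧
    ((∀ q : Q, Even (A.Ω q)) → A.language = Set.univ) := by
  exact ⟨fun e he => ⟨TreeAutomaton.isGame_dual hA he,
      TreeAutomaton.language_dual_withInit hA he hA.top_ne_init.symm,
      fun _ hq => TreeAutomaton.language_dual_withInit hA he hq⟩,
    TreeAutomaton.ncard_image_dual_Ω, TreeAutomaton.exists_even_ncard_range_dual_Ω,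
    TreeAutomaton.language_eq_univ_of_even hA⟩
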